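/- Let $(A,\mathfrak m)$ be a complete regular local ring and let $L$ be a finitely generated $A$-module. For an $A$-module $X$, write $\ell(X)$ for its length over $A$, and for a submodule $M\subseteq L$ write $\mu(M)$ for the minimal number of generators of $M$ over $A$. (1) If $L\neq 0$, then for every real $\varepsilon>0$ there is an integer $N>0$ such that every submodule $M\subseteq \mathfrak m^N L$ with $\ell(L/M)<\infty$ satisfies $$\mu(M)<\varepsilon\cdot \ell(L/M).$$ (2) For every real $\varepsilon>0$ there is an integer $N>0$ such that every submodule $M\subseteq L$ with $N<\ell(L/M)<\infty$ satisfies $$\mu(M)<\varepsilon\cdot \ell(L/M).$$ -/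

import Mathlib

open IsLocalRing

/-! Both parts follow from a bound μ(M) ≤ ε ℓ(L/M) + C, with C independent of M
(`hasSublinearSpanFinrank`). If every x ∈ 𝔪 acts nilpotently, L has finite length, which serves as
C. Otherwise choose x ∈ 𝔪 with no power killing L. By Nakayama, μ(M) is at most μ of the image of M
in L/xⁿ⁺¹L plus ℓ((M : xⁿ⁺¹)/(M : xⁿ)). The last length is at most ℓ(L/M)/(n+1), hence small for
large n, and Noetherian induction handles the proper quotient L/xⁿ⁺¹L. -/

theorem Submodule.spanFinrank_le_length {A M : Type*} [CommRing A] [IsLocalRing A]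
    [AddCommGroup M] [Module A M] (N : Submodule A M) (hN : N.FG) :
    (N.spanFinrank : ℕ∞) ≤ Module.length A N := by
  have : Module.Finite A N := Module.Finite.iff_fg.mpr hN
  let : Field (A ⧸ maximalIdeal A) := Ideal.Quotient.field _
  rw [spanFinrank_eq_finrank_quotient N hN]
  refine le_trans (Module.length_eq_finrank _ _).ge ?_
  rw [← Module.length_eq_of_surjective (S := A) (R := A ⧸ maximalIdeal A)
    Ideal.Quotient.mk_surjective]
  exact Module.length_le_of_surjective (mkQ _) (mkQ_surjective _)

theorem Module.length_lt_top_of_maximalIdeal_smul_eq_bot {A M : Type*} [CommRing A] [IsLocalRing A]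
    [AddCommGroup M] [Module A M] [Module.Finite A M]
    (h : maximalIdeal A • (⊤ : Submodule A M) = ⊥) : Module.length A M < ⊤ := by
  let : Field (A ⧸ maximalIdeal A) := Ideal.Quotient.field _
  refine lt_of_eq_of_lt ((Submodule.quotEquivOfEqBot _ h).length_eq).symm ?_
  rw [Module.length_eq_of_surjective (S := A) (R := A ⧸ maximalIdeal A)
    Ideal.Quotient.mk_surjective, Module.length_eq_finrank]
  exact ENat.natCast_lt_top _

theorem Submodule.length_quotient_eq_add {A M : Type*} [Ring A] [AddCommGroup M] [Module A M]
    {N P : Submodule A M} (h : N ≤ P) :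
    Module.length A (M ⧸ N) = Module.length A (P.map N.mkQ) + Module.length A (M ⧸ P) := by
  rw [← (Submodule.quotientQuotientEquivQuotient N P h).length_eq]
  exact Module.length_eq_add_of_exact (P.map N.mkQ).subtype (P.map N.mkQ).mkQ
    (injective_subtype _) (mkQ_surjective _) (LinearMap.exact_subtype_mkQ _)

theorem Module.length_lt_top_of_maximalIdeal_pow_smul_eq_bot {A M : Type*} [CommRing A]
    [IsLocalRing A] [IsNoetherianRing A] [AddCommGroup M] [Module A M] [Module.Finite A M] (n : ℕ)
    (h : maximalIdeal A ^ n • (⊤ : Submodule A M) = ⊥) : Module.length A M < ⊤ := by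
  suffices ∀ n : ℕ, Module.length A (M ⧸ maximalIdeal A ^ n • (⊤ : Submodule A M)) < ⊤ by
    rw [← (Submodule.quotEquivOfEqBot _ h).length_eq]
    exact this n
  intro n
  induction n with
  | zero =>
    rw [pow_zero, Ideal.one_eq_top, Submodule.top_smul, Module.length_eq_zero]
    exact ENat.natCast_lt_top 0
  | succ n ih =>
    have hle : maximalIdeal A ^ (n + 1) • (⊤ : Submodule A M) ≤ maximalIdeal A ^ n • ⊤ :=
      Submodule.smul_mono_left (Ideal.pow_le_pow_right n.le_succ)
    rw [Submodule.length_quotient_eq_add hle]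
    refine WithTop.add_lt_top.mpr ⟨Module.length_lt_top_of_maximalIdeal_smul_eq_bot ?_, ih⟩
    apply Submodule.map_injective_of_injective (Submodule.injective_subtype _)
    rw [Submodule.map_smul'', Submodule.map_subtype_top, ← Submodule.map_smul'',
      Submodule.map_bot, ← Submodule.mul_smul, ← pow_succ', ← Submodule.mkQ_map_self]

/-- The length of `(M : f ^ (n + 1)) / (M : f ^ n)` is at most that of `(M : f) / M`. -/
theorem Module.length_map_mkQ_comap_pow_le {A L : Type*} [CommRing A] [AddCommGroup L] [Module A L]
    (f : Module.End A L) (M : Submodule A L) (n : ℕ) :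
    Module.length A ((M.comap (f ^ (n + 1))).map (M.comap (f ^ n)).mkQ) ≤
      Module.length A ((M.comap f).map M.mkQ) := by
  let g : (L ⧸ M.comap (f ^ n)) →ₗ[A] L ⧸ M := Submodule.mapQ _ _ (f ^ n) le_rfl
  have hg : Function.Injective g := by
    rw [← LinearMap.ker_eq_bot, Submodule.ker_mapQ, Submodule.mkQ_map_self]
  have hmap : ∀ y ∈ (M.comap (f ^ (n + 1))).map (M.comap (f ^ n)).mkQ,
      g y ∈ (M.comap f).map M.mkQ := by
    rintro _ ⟨l, hl, rfl⟩
    refine ⟨(f ^ n) l, ?_, rfl⟩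
    simpa [pow_succ'] using hl
  refine Module.length_le_of_injective (g.restrict hmap) fun a b hab => ?_
  exact Subtype.ext (hg (congrArg Subtype.val hab))

/-- The layers of M ⊆ (M : f) ⊆ (M : f²) ⊆ ... have non-increasing length, and the first n + 1 of
them fit in L/M. The induction replaces M by (M : f). -/
theorem Module.succ_mul_length_map_mkQ_comap_pow_le {A L : Type*} [CommRing A] [AddCommGroup L]
    [Module A L] (f : Module.End A L) (n : ℕ) (M : Submodule A L) (hM : M ≤ M.comap f) :
    ((n + 1 : ℕ) : ℕ∞) *
      Module.length A ((M.comap (f ^ (n + 1))).map (M.comap (f ^ n)).mkQ) ≤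
      Module.length A (L ⧸ M) := by
  induction n generalizing M with
  | zero =>
    have h := Module.length_map_mkQ_comap_pow_le f M 0
    rw [Submodule.length_quotient_eq_add hM]
    simpa using h.trans le_self_add
  | succ n ih =>
    have h := ih (M.comap f) (Submodule.comap_mono hM)
    have e : ∀ k, (M.comap f).comap (f ^ k) = M.comap (f ^ (k + 1)) := fun k => by
      rw [pow_succ']; rfl
    rw [e, e] at h
    rw [Submodule.length_quotient_eq_add hM, Nat.cast_add, Nat.cast_one, add_mul, one_mul, add_comm]
    exact add_le_add (Module.length_map_mkQ_comap_pow_le f M (n + 1)) h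

theorem Submodule.exists_le_map_eq_spanFinrank_le {A M N : Type*} [CommRing A]
    [AddCommGroup M] [Module A M] [AddCommGroup N] [Module A N] (f : M →ₗ[A] N) (p : Submodule A M)
    (hp : p.FG) : ∃ q ≤ p, q.FG ∧ q.map f = p.map f ∧ q.spanFinrank ≤ (p.map f).spanFinrank := by
  classical
  obtain ⟨s, hs, hsp⟩ := (hp.map f).exists_span_finset_card_eq_spanFinrank
  have hsub : ∀ y ∈ s, ∃ z ∈ p, f z = y := fun y hy => by
    have : y ∈ p.map f := hsp ▸ subset_span hy
    exact this
  choose! g hgp hgf using hsub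
  have himg : f '' (s.image g : Finset M) = s := by
    rw [Finset.coe_image, ← Set.image_comp]
    exact (Set.image_congr hgf).trans (Set.image_id' _)
  refine ⟨span A (s.image g : Finset M), span_le.mpr ?_, fg_span (Finset.finite_toSet _), ?_, ?_⟩
  · rw [Finset.coe_image]
    rintro _ ⟨y, hy, rfl⟩
    exact hgp y hy
  · rw [map_span, himg, hsp]
  · refine (spanFinrank_span_le_ncard_of_finite (Finset.finite_toSet _)).trans ?_
    rw [Set.ncard_coe_finset, ← hs]
    exact Finset.card_image_le

theorem Submodule.FG.spanFinrank_sup_le {A M : Type*} [CommRing A]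
    [AddCommGroup M] [Module A M] {p q : Submodule A M} (hp : p.FG) (hq : q.FG) :
    (p ⊔ q).spanFinrank ≤ p.spanFinrank + q.spanFinrank := by
  rw [← (hp.sup hq).spanRank_le_iff, Nat.cast_add, ← hp.spanRank_eq_spanFinrank,
    ← hq.spanRank_eq_spanFinrank]
  exact spanRank_sup_le_sum_spanRank

/-- The kernel of M → L/xⁿ⁺¹L is xⁿ⁺¹(M : xⁿ⁺¹), and xⁿ⁺¹(M : xⁿ) ⊆ xM is negligible by Nakayama. So
only generators of (M : xⁿ⁺¹)/(M : xⁿ) are needed there. -/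
theorem spanFinrank_le_map_mkQ_add_length {A L : Type*} [CommRing A] [IsLocalRing A]
    [AddCommGroup L] [Module A L] [IsNoetherian A L] {x : A} (hx : x ∈ maximalIdeal A)
    (n : ℕ) (M : Submodule A L) :
    (M.spanFinrank : ℕ∞) ≤
      (M.map (LinearMap.range (LinearMap.lsmul A L x ^ (n + 1))).mkQ).spanFinrank +
      Module.length A ((M.comap (LinearMap.lsmul A L x ^ (n + 1))).map
        (M.comap (LinearMap.lsmul A L x ^ n)).mkQ) := by
  set f : Module.End A L := LinearMap.lsmul A L x with hf
  obtain ⟨q, hqM, hq, hqmap, hqr⟩ := M.exists_le_map_eq_spanFinrank_le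
    (LinearMap.range (f ^ (n + 1))).mkQ (IsNoetherian.noetherian M)
  obtain ⟨r, hrM, hr, hrmap, hrr⟩ := (M.comap (f ^ (n + 1))).exists_le_map_eq_spanFinrank_le
    (M.comap (f ^ n)).mkQ (IsNoetherian.noetherian _)
  have key : M ≤ q ⊔ r.map (f ^ (n + 1)) := by
    refine Submodule.le_of_le_smul_of_le_jacobson_bot (I := maximalIdeal A)
      (IsNoetherian.noetherian M) (jacobson_eq_maximalIdeal ⊥ bot_ne_top).ge ?_
    intro m hm
    obtain ⟨a, ha, hma⟩ := hqmap.ge (Submodule.mem_map_of_mem hm)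
    obtain ⟨l, hl⟩ := (Submodule.Quotient.eq _).mp hma.symm
    have hlM : l ∈ M.comap (f ^ (n + 1)) := by
      rw [Submodule.mem_comap, hl]
      exact M.sub_mem hm (hqM ha)
    obtain ⟨b, hb, hlb⟩ := hrmap.ge (Submodule.mem_map_of_mem hlM)
    have hlb' : (f ^ n) (l - b) ∈ M := (Submodule.Quotient.eq _).mp hlb.symm
    have hm' : m = a + (f ^ (n + 1)) b + x • (f ^ n) (l - b) := by
      have : x • (f ^ n) (l - b) = (f ^ (n + 1)) (l - b) := by
        rw [pow_succ']; rfl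
      rw [this, map_sub, hl]
      abel
    rw [hm']
    exact Submodule.add_mem_sup (Submodule.add_mem_sup ha (Submodule.mem_map_of_mem hb))
      (Submodule.smul_mem_smul hx hlb')
  have hkey : M = q ⊔ r.map (f ^ (n + 1)) :=
    le_antisymm key (sup_le hqM (Submodule.map_le_iff_le_comap.mpr hrM))
  have h1 : M.spanFinrank ≤ (M.map (LinearMap.range (f ^ (n + 1))).mkQ).spanFinrank +
      ((M.comap (f ^ (n + 1))).map (M.comap (f ^ n)).mkQ).spanFinrank := by
    calc M.spanFinrank = (q ⊔ r.map (f ^ (n + 1))).spanFinrank := by rw [← hkey]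
      _ ≤ q.spanFinrank + (r.map (f ^ (n + 1))).spanFinrank :=
        Submodule.FG.spanFinrank_sup_le hq (hr.map _)
      _ ≤ _ := add_le_add hqr ((Submodule.spanFinrank_map_le_of_fg _ hr).trans hrr)
  refine (Nat.cast_le.mpr h1).trans ?_
  rw [Nat.cast_add]
  gcongr
  exact Submodule.spanFinrank_le_length _ (IsNoetherian.noetherian _)

/-- The minimal number of generators of submodules of finite colength of `L` grows slower than any
positive multiple of the colength. -/
def HasSublinearSpanFinrank (A L : Type*) [CommRing A] [AddCommGroup L] [Module A L] : Prop :=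
  ∀ ε : ℝ, 0 < ε → ∃ C : ℝ, ∀ M : Submodule A L, Module.length A (L ⧸ M) < ⊤ →
    (M.spanFinrank : ℝ) ≤ ε * ((Module.length A (L ⧸ M)).toNat : ℝ) + C

theorem HasSublinearSpanFinrank.of_length_lt_top {A L : Type*} [CommRing A] [IsLocalRing A]
    [AddCommGroup L] [Module A L] [IsNoetherian A L] (h : Module.length A L < ⊤) :
    HasSublinearSpanFinrank A L := by
  intro ε hε
  refine ⟨(Module.length A L).toNat, fun M _ => ?_⟩
  have h1 : (M.spanFinrank : ℕ∞) ≤ Module.length A L :=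
    (M.spanFinrank_le_length (IsNoetherian.noetherian M)).trans
      (Module.length_le_of_injective M.subtype M.injective_subtype)
  have h2 : M.spanFinrank ≤ (Module.length A L).toNat := by
    rwa [← ENat.natCast_toNat h.ne, Nat.cast_le] at h1
  have h3 : (M.spanFinrank : ℝ) ≤ (Module.length A L).toNat := Nat.cast_le.mpr h2
  exact h3.trans (le_add_of_nonneg_left (by positivity))

theorem HasSublinearSpanFinrank.of_quotient_range_pow {A L : Type*} [CommRing A] [IsLocalRing A]
    [AddCommGroup L] [Module A L] [IsNoetherian A L] {x : A} (hx : x ∈ maximalIdeal A)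
    (h : ∀ n : ℕ, HasSublinearSpanFinrank A (L ⧸ LinearMap.range (LinearMap.lsmul A L x ^ n))) :
    HasSublinearSpanFinrank A L := by
  intro ε hε
  obtain ⟨n, hn⟩ := exists_nat_one_div_lt (half_pos hε)
  obtain ⟨C, hC⟩ := h (n + 1) (ε / 2) (half_pos hε)
  refine ⟨C, fun M hM => ?_⟩
  set f : Module.End A L := LinearMap.lsmul A L x with hf
  set R := LinearMap.range (f ^ (n + 1))
  have hMf : M ≤ M.comap f := fun m hm => M.smul_mem x hm
  have h1 := spanFinrank_le_map_mkQ_add_length hx n M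
  have h2 := Module.succ_mul_length_map_mkQ_comap_pow_le f n M hMf
  have h3 : Module.length A ((L ⧸ R) ⧸ M.map R.mkQ) ≤ Module.length A (L ⧸ M) := by
    refine Module.length_le_of_surjective
      (Submodule.mapQ M (M.map R.mkQ) R.mkQ (Submodule.le_comap_map _ _)) ?_
    intro y
    obtain ⟨y, rfl⟩ := Submodule.mkQ_surjective _ y
    obtain ⟨l, rfl⟩ := Submodule.mkQ_surjective _ y
    exact ⟨Submodule.Quotient.mk l, rfl⟩
  have h4 := hC (M.map R.mkQ) (h3.trans_lt hM)
  rw [← hf] at h1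
  set a := Module.length A ((M.comap (f ^ (n + 1))).map (M.comap (f ^ n)).mkQ)
  have ha : a < ⊤ := by
    refine lt_of_le_of_lt ?_ (h2.trans_lt hM)
    exact le_mul_of_one_le_left' (by simp)
  clear_value a
  generalize Module.length A ((L ⧸ R) ⧸ M.map R.mkQ) = c at *
  generalize Module.length A (L ⧸ M) = b at *
  lift a to ℕ using ha.ne
  lift b to ℕ using hM.ne
  lift c to ℕ using (h3.trans_lt hM).ne
  simp only [ENat.toNat_natCast] at *
  have h1' : (M.spanFinrank : ℝ) ≤ (M.map R.mkQ).spanFinrank + a := by exact_mod_cast h1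
  have h2' : ((n : ℝ) + 1) * a ≤ b := by exact_mod_cast h2
  have h3' : (c : ℝ) ≤ b := by exact_mod_cast h3
  have h5 : (a : ℝ) ≤ ε / 2 * b := by
    calc (a : ℝ) ≤ b / ((n : ℝ) + 1) := by rw [le_div_iff₀ (by positivity)]; linarith
      _ = 1 / ((n : ℝ) + 1) * b := by ring
      _ ≤ ε / 2 * b := by gcongr
  have h6 : ε / 2 * c ≤ ε / 2 * b := by gcongr
  linarith

theorem hasSublinearSpanFinrank.{u, v} {A : Type v} [CommRing A] [IsLocalRing A] [IsNoetherianRing A]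
    (L : Type u) [AddCommGroup L] [Module A L] [Module.Finite A L] :
    HasSublinearSpanFinrank A L := by
  -- Quotients of L are indexed by their kernels, so that the ascending chain condition on
  -- submodules of L drives the induction.
  suffices ∀ (N : Submodule A L) (X : Type u) [AddCommGroup X] [Module A X] (f : L →ₗ[A] X),
      Function.Surjective f → LinearMap.ker f = N → HasSublinearSpanFinrank A X from
    this _ L LinearMap.id Function.surjective_id rfl
  intro N
  induction N using IsNoetherian.induction with | hgt N ih => ?_
  intro X _ _ f hf hfN
  have : Module.Finite A X := Module.Finite.of_surjective f hf
  by_cases hx : ∃ x ∈ maximalIdeal A, ∀ n : ℕ,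
      LinearMap.range (LinearMap.lsmul A X x ^ n) ≠ ⊥
  · obtain ⟨x, hxm, hx⟩ := hx
    refine .of_quotient_range_pow hxm fun n => ?_
    refine ih _ ?_ _ ((LinearMap.range (LinearMap.lsmul A X x ^ n)).mkQ ∘ₗ f)
      ((Submodule.mkQ_surjective _).comp hf) rfl
    rw [← hfN, LinearMap.ker_comp, Submodule.ker_mkQ, ← Submodule.comap_bot]
    exact Submodule.comap_strictMono_of_surjective hf (bot_lt_iff_ne_bot.mpr (hx n))
  · push Not at hx
    -- Each x ∈ 𝔪 is now nilpotent on X, so a power of 𝔪 kills X.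
    have hrad : maximalIdeal A ≤ (Module.annihilator A X).radical := by
      intro x hxm
      obtain ⟨n, hn⟩ := hx x hxm
      refine ⟨n, Module.mem_annihilator.mpr fun y => ?_⟩
      have hpow : ∀ k : ℕ, (LinearMap.lsmul A X x ^ k) y = x ^ k • y := fun k => by
        induction k with
        | zero => simp
        | succ k ihk => rw [pow_succ', Module.End.mul_apply, ihk, LinearMap.lsmul_apply, pow_succ',
            mul_smul]
      rw [← hpow, LinearMap.range_eq_bot.mp hn, LinearMap.zero_apply]
    obtain ⟨n, hn⟩ := Ideal.exists_pow_le_of_le_radical_of_fg hrad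
      (IsNoetherian.noetherian (maximalIdeal A))
    refine .of_length_lt_top (Module.length_lt_top_of_maximalIdeal_pow_smul_eq_bot n ?_)
    rw [← le_bot_iff, Submodule.smul_le]
    intro r hr y _
    exact Module.mem_annihilator.mp (hn hr) y

/-- By Nakayama the chain 𝔪ᵏL drops strictly until it reaches zero. -/
theorem natCast_le_length_quotient_maximalIdeal_pow {A L : Type*} [CommRing A] [IsLocalRing A]
    [AddCommGroup L] [Module A L] [IsNoetherian A L] (n : ℕ)
    (h : maximalIdeal A ^ n • (⊤ : Submodule A L) ≠ ⊥) :
    (n : ℕ∞) ≤ Module.length A (L ⧸ maximalIdeal A ^ n • (⊤ : Submodule A L)) := by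
  induction n with
  | zero => simp
  | succ n ih =>
    have hle : maximalIdeal A ^ (n + 1) • (⊤ : Submodule A L) ≤ maximalIdeal A ^ n • ⊤ :=
      Submodule.smul_mono_left (Ideal.pow_le_pow_right n.le_succ)
    have hlt : maximalIdeal A ^ (n + 1) • (⊤ : Submodule A L) < maximalIdeal A ^ n • ⊤ := by
      refine lt_of_le_of_ne hle fun heq => h ?_
      rw [heq]
      refine Submodule.eq_bot_of_le_smul_of_le_jacobson_bot (maximalIdeal A) _
        (IsNoetherian.noetherian _) ?_ (jacobson_eq_maximalIdeal ⊥ bot_ne_top).ge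
      rw [← Submodule.mul_smul, ← pow_succ', heq]
    rw [Module.length_quotient] at ih ⊢
    rw [Nat.cast_succ]
    refine le_trans ?_ (Order.coheight_add_one_le hlt)
    gcongr
    exact ih fun h0 => h (le_bot_iff.mp (hle.trans h0.le))

theorem theorem3p3 {A : Type*} [CommRing A] [IsRegularLocalRing A]
    [IsAdicComplete (IsLocalRing.maximalIdeal A) A]
    (L : Type*) [AddCommGroup L] [Module A L] [Module.Finite A L] :
    (Nontrivial L → ∀ ε : ℝ, 0 < ε → ∃ N : ℕ, 0 < N ∧ ∀ M : Submodule A L,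
      M ≤ IsLocalRing.maximalIdeal A ^ N • (⊤ : Submodule A L) →
      Module.length A (L ⧸ M) < ⊤ →
      (M.spanFinrank : ℝ) < ε * ((Module.length A (L ⧸ M)).toNat : ℝ)) ∧
    (∀ ε : ℝ, 0 < ε → ∃ N : ℕ, 0 < N ∧ ∀ M : Submodule A L,
      (N : ℕ∞) < Module.length A (L ⧸ M) →
      Module.length A (L ⧸ M) < ⊤ →
      (M.spanFinrank : ℝ) < ε * ((Module.length A (L ⧸ M)).toNat : ℝ)) := by
  have large : ∀ ε : ℝ, 0 < ε → ∃ N : ℕ, 0 < N ∧ ∀ M : Submodule A L,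
      (N : ℕ∞) ≤ Module.length A (L ⧸ M) → Module.length A (L ⧸ M) < ⊤ →
      (M.spanFinrank : ℝ) < ε * ((Module.length A (L ⧸ M)).toNat : ℝ) := by
    intro ε hε
    obtain ⟨C, hC⟩ := hasSublinearSpanFinrank (A := A) L (ε / 2) (half_pos hε)
    -- Once the colength exceeds n, the unused half of ε absorbs C.
    obtain ⟨n, hn⟩ := exists_nat_gt (C / (ε / 2))
    refine ⟨n + 1, n.succ_pos, fun M hNM hM => (hC M hM).trans_lt ?_⟩
    generalize Module.length A (L ⧸ M) = b at *
    lift b to ℕ using hM.ne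
    rw [ENat.toNat_natCast]
    have hCn : C < n * (ε / 2) := (div_lt_iff₀ (half_pos hε)).mp hn
    have hnb : n * (ε / 2) ≤ b * (ε / 2) := by
      gcongr
      exact n.le_succ.trans (Nat.cast_le.mp hNM)
    linarith
  refine ⟨fun _ ε hε => ?_, fun ε hε => ?_⟩
  · obtain ⟨N, hN, h⟩ := large ε hε
    refine ⟨N, hN, fun M hM hlen => ?_⟩
    -- If 𝔪ᴺL = 0 the colength may be below N, but then M = 0 and L ≠ 0 give the strict inequality.
    by_cases h0 : IsLocalRing.maximalIdeal A ^ N • (⊤ : Submodule A L) = ⊥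
    · obtain rfl : M = ⊥ := le_bot_iff.mp (hM.trans h0.le)
      have hpos : 0 < Module.length A (L ⧸ (⊥ : Submodule A L)) := by
        rw [(Submodule.quotEquivOfEqBot _ rfl).length_eq]
        exact Module.length_pos
      have hpos' : 0 < (Module.length A (L ⧸ (⊥ : Submodule A L))).toNat :=
        Nat.pos_of_ne_zero fun h => (ENat.toNat_eq_zero.mp h).elim hpos.ne' hlen.ne
      rw [Submodule.spanFinrank_bot, Nat.cast_zero]
      positivity
    · refine h M ((natCast_le_length_quotient_maximalIdeal_pow N h0).trans ?_) hlen
      exact Module.length_le_of_surjective (Submodule.factor hM) (Submodule.factor_surjective hM)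
  · obtain ⟨N, hN, h⟩ := large ε hε
    exact ⟨N, hN, fun M hM hlen => h M hM.le hlen⟩
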